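/- All graphs are finite and simple. For a connected graph $G$ with vertex set $V$, let $D(G)=[d(i,j)]_{i,j\in V}$ be its distance matrix, where $d(i,j)$ is the length of a shortest path from $i$ to $j$. For a square matrix $B$, let $\operatorname{cof} B=\mathbf 1^{t}\,(\operatorname{Adj} B)\,\mathbf 1$ denote the sum of all cofactors of $B$. A vertex $v$ of a graph $H$ is a cut-vertex if $H-v$ is disconnected; a block of $G$ is a maximal connected subgraph of $G$ that has no cut-vertex. A connected graph $G$ is called a multi-block graph if each of its blocks is a complete $m$-partite graph $K_{n_1,\dots,n_m}$ for some $m\ge 2$ and $n_1,\dots,n_m\ge 1$ (depending on the block). Theorem. Let $G$ be a multi-block graph with blocks $G_t$, $1\le t\le b$. Suppose that $\operatorname{cof} D(G_t)\ne 0$ for all $1\le t\le b$, and put $$\lambda_G=\sum_{t=1}^{b}\lambda_{G_t},\qquad \lambda_{G_t}=\frac{\det D(G_t)}{\operatorname{cof} D(G_t)} .$$ Then $$\det D(G)=\lambda_G\prod_{t=1}^{b}\operatorname{cof} D(G_t)=\lambda_G\,\operatorname{cof} D(G).$$ -/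

import Mathlib

namespace SimpleGraph

universe u

/-- `v` is a cut-vertex of `G` if the graph `G - v` is disconnected. `Preconnected` is used so that
the graph without vertices, left when the only vertex of a one-vertex graph is deleted, does not
count as disconnected. -/
def IsCutVertex {V : Type u} (G : SimpleGraph V) (v : V) : Prop :=
  ¬ (G.induce ({v}ᶜ : Set V)).Preconnected

/-- A block of `G` is a maximal connected subgraph of `G` that has no cut-vertex (of its own). -/
def IsBlock {V : Type u} (G : SimpleGraph V) (B : G.Subgraph) : Prop :=
  Maximal (fun H : G.Subgraph => H.Connected ∧ ∀ v : H.verts, ¬ H.coe.IsCutVertex v) B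

/-- `G` is a complete `m`-partite graph `K_{n_1, …, n_m}` for some `m ≥ 2` and `n_i ≥ 1`. -/
def IsCompletePartite {V : Type u} (G : SimpleGraph V) : Prop :=
  ∃ m : ℕ, 2 ≤ m ∧ ∃ n : Fin m → ℕ, (∀ i, 1 ≤ n i) ∧
    Nonempty (G ≃g completeMultipartiteGraph (fun i : Fin m => Fin (n i)))

/-- A multi-block graph is a connected graph each of whose blocks is a complete `m`-partite graph
for some `m ≥ 2` (which may differ from block to block). -/
def IsMultiBlock {V : Type u} (G : SimpleGraph V) : Prop :=
  G.Connected ∧ ∀ B : G.Subgraph, G.IsBlock B → B.coe.IsCompletePartite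

/-- The finite set of all blocks of a finite graph. -/
noncomputable def blocks {V : Type u} [Fintype V] (G : SimpleGraph V) : Finset G.Subgraph :=
  (Set.toFinite {B : G.Subgraph | G.IsBlock B}).toFinset

/-- The distance matrix `D(G)`. -/
noncomputable def distMatrix {V : Type u} (G : SimpleGraph V) : Matrix V V ℝ :=
  Matrix.of fun i j => (G.dist i j : ℝ)

end SimpleGraph

/-- `cof B`, the sum of all cofactors of `B`, that is `𝟙ᵗ (Adj B) 𝟙`. -/
def Matrix.cofactorSum {n : Type*} [Fintype n] [DecidableEq n] (B : Matrix n n ℝ) : ℝ :=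
  ∑ i, ∑ j, B.adjugate i j

namespace SimpleGraph

open scoped Classical in
/-- `λ = det D(H) / cof D(H)` for a single block `H`; meaningful when `cof D(H) ≠ 0`. -/
noncomputable def lambdaSingle {V : Type*} [Fintype V] (H : SimpleGraph V) : ℝ :=
  H.distMatrix.det / H.distMatrix.cofactorSum

open scoped Classical in
/-- `λ_G`, the sum of `λ_{G_t}` over all blocks `G_t` of `G`. -/
noncomputable def lambdaMulti {V : Type*} [Fintype V] (G : SimpleGraph V) : ℝ :=
  ∑ B ∈ G.blocks, B.coe.lambdaSingle

end SimpleGraph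

/-! This is the Graham–Hoffman–Hosoya argument. Let `M` have zero diagonal entry at `v`. Subtracting
row and column `v` from the others leaves a border around the matrix `C` with entries `M i j - M i v
- M v j`. Then `cof M = det C` (`cofactorSum_eq_det_centered`), and by a Schur complement `det M /
cof M = -r C⁻¹ c`, where `r` and `c` are the border row and column (`det_div_cofactorSum`). If a
connected graph is glued from two parts at `v`, every distance between the parts is a sum through
`v` (`IsGluing.dist_left_right`), so `C` is block diagonal: `cof` multiplies and `λ = det / cof`
adds. Induction on the number of vertices concludes (`cofactorSum_and_lambdaSingle_induce`): a
vertex set with a cut-vertex is such a gluing of two smaller ones, and its blocks are the disjoint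
union of theirs. -/

namespace Matrix

/-! ### Determinant and cofactor sum of a matrix relative to a distinguished index. -/

section Bordered

variable {α β : Type*} [Fintype α] [DecidableEq α] [Fintype β] [DecidableEq β]

theorem cofactorSum_submatrix_equiv {m n : Type*} [Fintype m] [DecidableEq m] [Fintype n]
    [DecidableEq n] (e : m ≃ n) (B : Matrix n n ℝ) :
    (B.submatrix e e).cofactorSum = B.cofactorSum := by
  simp only [cofactorSum, adjugate_submatrix_equiv_self, submatrix_apply]
  rw [← e.sum_comp]
  exact Finset.sum_congr rfl fun i _ => e.sum_comp (fun j => B.adjugate (e i) j)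

/-- The matrix `m i j - m i v - m v j` on the indices other than the distinguished one `v`. -/
def centered (M : Matrix (Unit ⊕ α) (Unit ⊕ α) ℝ) : Matrix α α ℝ :=
  of fun i j => M (.inr i) (.inr j) - M (.inr i) (.inl ()) - M (.inl ()) (.inr j)

/-- The unipotent matrix that subtracts the distinguished row from all the others. -/
def pivot (α : Type*) [DecidableEq α] : Matrix (Unit ⊕ α) (Unit ⊕ α) ℝ :=
  fromBlocks 1 0 (of fun _ _ => -1) 1

theorem det_pivot : (pivot α).det = 1 := by
  simp [pivot]

theorem pivot_mul_mul_transpose (M : Matrix (Unit ⊕ α) (Unit ⊕ α) ℝ)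
    (h : M (.inl ()) (.inl ()) = 0) :
    pivot α * M * (pivot α)ᵀ = fromBlocks 0 M.toBlocks₁₂ M.toBlocks₂₁ M.centered := by
  conv_lhs => rw [← fromBlocks_toBlocks M]
  have h11 : M.toBlocks₁₁ = 0 := by ext; simpa [toBlocks₁₁] using h
  rw [pivot, fromBlocks_transpose, fromBlocks_multiply, fromBlocks_multiply, h11]
  congr 1
  · simp
  · simp
  · simp
  · ext i j
    simp [centered, toBlocks₁₂, toBlocks₂₁, toBlocks₂₂, mul_apply]
    ring

theorem det_eq_det_fromBlocks_centered (M : Matrix (Unit ⊕ α) (Unit ⊕ α) ℝ)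
    (h : M (.inl ()) (.inl ()) = 0) :
    M.det = (fromBlocks 0 M.toBlocks₁₂ M.toBlocks₂₁ M.centered).det := by
  rw [← pivot_mul_mul_transpose M h, det_mul, det_mul, det_transpose, det_pivot]
  ring

theorem cofactorSum_eq_dotProduct {n : Type*} [Fintype n] [DecidableEq n] (B : Matrix n n ℝ) :
    B.cofactorSum = (fun _ => 1) ⬝ᵥ (B.adjugate *ᵥ fun _ => 1) := by
  simp [cofactorSum, dotProduct, mulVec]

theorem pivot_mulVec_one :
    pivot α *ᵥ (fun _ => 1) = Pi.single (.inl ()) 1 := by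
  ext (i | i) <;> simp [pivot, mulVec, dotProduct, one_apply]

/-- With `P` the pivot matrix, `det P = 1` gives `adj M = Pᵀ adj(P M Pᵀ) P`, and `P 𝟙` is the unit
vector at the distinguished index. Hence `𝟙ᵗ (adj M) 𝟙` is a single cofactor of the bordered matrix,
the one that deletes the border. -/
theorem cofactorSum_eq_det_centered (M : Matrix (Unit ⊕ α) (Unit ⊕ α) ℝ)
    (h : M (.inl ()) (.inl ()) = 0) : M.cofactorSum = M.centered.det := by
  have key : M.adjugate = (pivot α)ᵀ * (pivot α * M * (pivot α)ᵀ).adjugate * pivot α := by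
    have h1 : (pivot α).adjugate * pivot α = 1 := by rw [adjugate_mul, det_pivot, one_smul]
    have h2 : (pivot α)ᵀ * (pivot α)ᵀ.adjugate = 1 := by
      rw [mul_adjugate, det_transpose, det_pivot, one_smul]
    rw [adjugate_mul_distrib, adjugate_mul_distrib]
    calc M.adjugate = ((pivot α)ᵀ * (pivot α)ᵀ.adjugate) * M.adjugate *
          ((pivot α).adjugate * pivot α) := by rw [h1, h2, Matrix.one_mul, Matrix.mul_one]
      _ = _ := by simp only [Matrix.mul_assoc]
  rw [cofactorSum_eq_dotProduct, key, ← mulVec_mulVec, ← mulVec_mulVec, pivot_mulVec_one,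
    dotProduct_mulVec, vecMul_transpose, pivot_mulVec_one, single_one_dotProduct,
    mulVec_single_one, col_apply, pivot_mul_mul_transpose M h, adjugate_apply]
  have : (fromBlocks (0 : Matrix Unit Unit ℝ) M.toBlocks₁₂ M.toBlocks₂₁ M.centered).updateRow
      (.inl ()) (Pi.single (.inl ()) 1) = fromBlocks 1 0 M.toBlocks₂₁ M.centered := by
    ext (i | i) (j | j) <;> simp [updateRow_apply]
  rw [this, det_fromBlocks_zero₁₂, det_one, one_mul]

theorem det_div_cofactorSum (M : Matrix (Unit ⊕ α) (Unit ⊕ α) ℝ)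
    (h : M (.inl ()) (.inl ()) = 0) (hc : M.cofactorSum ≠ 0) :
    M.det / M.cofactorSum =
      -((fun j => M (.inl ()) (.inr j)) ⬝ᵥ (M.centered⁻¹ *ᵥ fun i => M (.inr i) (.inl ()))) := by
  rw [cofactorSum_eq_det_centered M h] at hc ⊢
  let := invertibleOfIsUnitDet M.centered (isUnit_iff_ne_zero.2 hc)
  rw [det_eq_det_fromBlocks_centered M h, det_fromBlocks₂₂, mul_div_cancel_left₀ _ hc,
    det_unique, zero_sub, neg_apply, invOf_eq_nonsing_inv, Matrix.mul_assoc]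
  rfl

-- Additivity through the distinguished index is exactly the vanishing of the off-diagonal blocks
-- after centering.
omit [Fintype α] [DecidableEq α] [Fintype β] [DecidableEq β] in
theorem centered_of_glue (M : Matrix (Unit ⊕ (α ⊕ β)) (Unit ⊕ (α ⊕ β)) ℝ)
    (hab : ∀ a b, M (.inr (.inl a)) (.inr (.inr b)) =
      M (.inr (.inl a)) (.inl ()) + M (.inl ()) (.inr (.inr b)))
    (hba : ∀ a b, M (.inr (.inr b)) (.inr (.inl a)) =
      M (.inr (.inr b)) (.inl ()) + M (.inl ()) (.inr (.inl a))) :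
    M.centered = fromBlocks
      (M.submatrix (Sum.map id .inl) (Sum.map id .inl)).centered 0 0
      (M.submatrix (Sum.map id .inr) (Sum.map id .inr)).centered := by
  ext (i | i) (j | j) <;> simp [centered, hab, hba]

theorem cofactorSum_of_glue (M : Matrix (Unit ⊕ (α ⊕ β)) (Unit ⊕ (α ⊕ β)) ℝ)
    (h : M (.inl ()) (.inl ()) = 0)
    (hab : ∀ a b, M (.inr (.inl a)) (.inr (.inr b)) =
      M (.inr (.inl a)) (.inl ()) + M (.inl ()) (.inr (.inr b)))
    (hba : ∀ a b, M (.inr (.inr b)) (.inr (.inl a)) =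
      M (.inr (.inr b)) (.inl ()) + M (.inl ()) (.inr (.inl a))) :
    M.cofactorSum = (M.submatrix (Sum.map id .inl) (Sum.map id .inl)).cofactorSum *
      (M.submatrix (Sum.map id .inr) (Sum.map id .inr)).cofactorSum := by
  rw [cofactorSum_eq_det_centered M h, cofactorSum_eq_det_centered _ (by simpa using h),
    cofactorSum_eq_det_centered _ (by simpa using h), centered_of_glue M hab hba,
    det_fromBlocks_zero₁₂]

theorem det_div_cofactorSum_of_glue (M : Matrix (Unit ⊕ (α ⊕ β)) (Unit ⊕ (α ⊕ β)) ℝ)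
    (h : M (.inl ()) (.inl ()) = 0)
    (hab : ∀ a b, M (.inr (.inl a)) (.inr (.inr b)) =
      M (.inr (.inl a)) (.inl ()) + M (.inl ()) (.inr (.inr b)))
    (hba : ∀ a b, M (.inr (.inr b)) (.inr (.inl a)) =
      M (.inr (.inr b)) (.inl ()) + M (.inl ()) (.inr (.inl a)))
    (hA : (M.submatrix (Sum.map id Sum.inl) (Sum.map id Sum.inl)).cofactorSum ≠ 0)
    (hB : (M.submatrix (Sum.map id Sum.inr) (Sum.map id Sum.inr)).cofactorSum ≠ 0) :
    M.det / M.cofactorSum =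
      (M.submatrix (Sum.map id .inl) (Sum.map id .inl)).det /
        (M.submatrix (Sum.map id .inl) (Sum.map id .inl)).cofactorSum +
      (M.submatrix (Sum.map id .inr) (Sum.map id .inr)).det /
        (M.submatrix (Sum.map id .inr) (Sum.map id .inr)).cofactorSum := by
  have hM : M.cofactorSum ≠ 0 := by
    rw [cofactorSum_of_glue M h hab hba]
    exact mul_ne_zero hA hB
  rw [det_div_cofactorSum M h hM, det_div_cofactorSum _ (by simpa using h) hA,
    det_div_cofactorSum _ (by simpa using h) hB, centered_of_glue M hab hba]
  rw [cofactorSum_eq_det_centered _ (by simpa using h)] at hA hB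
  -- Both diagonal blocks are invertible, so the inverse is block diagonal and the bilinear form
  -- splits.
  rw [inv_fromBlocks_zero₁₂_of_isUnit_iff _ _ _ (by
    simp only [isUnit_iff_isUnit_det, isUnit_iff_ne_zero, ne_eq, hA, hB])]
  simp [dotProduct, mulVec, Fintype.sum_sum_type]
  ring

end Bordered

end Matrix

namespace SimpleGraph

/-! ### Distances in a graph glued from two parts at one vertex. -/

section Gluing

variable {V W : Type*}

theorem Iso.dist_eq {G : SimpleGraph V} {H : SimpleGraph W} (e : G ≃g H) (a b : V) :
    H.dist (e a) (e b) = G.dist a b := by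
  simp only [dist]
  congr 1
  apply le_antisymm
  · refine le_iInf fun p => ?_
    simpa using edist_le (p.map e.toHom)
  · refine le_iInf fun p => ?_
    simpa using edist_le ((p.map e.symm.toHom).copy (e.symm_apply_apply a) (e.symm_apply_apply b))

theorem Iso.distMatrix_submatrix {G : SimpleGraph V} {H : SimpleGraph W} (e : G ≃g H) :
    H.distMatrix.submatrix e e = G.distMatrix := by
  ext a b
  simp [distMatrix, e.dist_eq]

theorem Iso.cofactorSum_distMatrix [Fintype V] [DecidableEq V] [Fintype W] [DecidableEq W]
    {G : SimpleGraph V} {H : SimpleGraph W} (e : G ≃g H) :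
    G.distMatrix.cofactorSum = H.distMatrix.cofactorSum := by
  rw [← e.distMatrix_submatrix]
  exact Matrix.cofactorSum_submatrix_equiv e.toEquiv _

theorem Iso.det_distMatrix [Fintype V] [DecidableEq V] [Fintype W] [DecidableEq W]
    {G : SimpleGraph V} {H : SimpleGraph W} (e : G ≃g H) :
    G.distMatrix.det = H.distMatrix.det := by
  rw [← e.distMatrix_submatrix]
  exact Matrix.det_submatrix_equiv_self e.toEquiv _

theorem lambdaSingle_eq [Fintype V] [DecidableEq V] (G : SimpleGraph V) :
    G.lambdaSingle = G.distMatrix.det / G.distMatrix.cofactorSum := by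
  simp only [lambdaSingle]
  congr!

theorem Iso.lambdaSingle_eq [Fintype V] [Fintype W] {G : SimpleGraph V} {H : SimpleGraph W}
    (e : G ≃g H) : G.lambdaSingle = H.lambdaSingle := by
  classical
  rw [SimpleGraph.lambdaSingle_eq, SimpleGraph.lambdaSingle_eq, e.det_distMatrix,
    e.cofactorSum_distMatrix]

/-- A potential that grows by at most one along each edge bounds walk lengths from below; applied to
`partDist`. -/
theorem le_dist_of_lipschitz {G : SimpleGraph V} {a b : V} (h : G.Reachable a b) (f : V → ℕ)
    (h0 : f a = 0) (hf : ∀ x y, G.Adj x y → f y ≤ f x + 1) : f b ≤ G.dist a b := by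
  obtain ⟨p, hp⟩ := h.exists_walk_length_eq_dist
  rw [← hp]
  have aux : ∀ {x y : V} (q : G.Walk x y), f y ≤ f x + q.length := by
    intro x y q
    induction q with
    | nil => simp
    | cons hxy q ih =>
      have := hf _ _ hxy
      rw [Walk.length_cons]
      omega
  simpa [h0] using aux p

theorem dist_hom_le {G : SimpleGraph V} {H : SimpleGraph W} (φ : G →g H) {a b : V}
    (h : G.Reachable a b) : H.dist (φ a) (φ b) ≤ G.dist a b := by
  obtain ⟨p, hp⟩ := h.exists_walk_length_eq_dist
  rw [← hp]
  simpa using dist_le (p.map φ)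

theorem Adj.dist_le_dist_add_one {G : SimpleGraph V} {x y : V} (h : G.Adj x y) (a : V) :
    G.dist a y ≤ G.dist a x + 1 := by
  have := h.reachable.dist_triangle_right a
  rwa [dist_eq_one_iff_adj.2 h] at this

/-- The set `S` is the union of two sets that share exactly the vertex `v` and carry connected
subgraphs, with no further edges between them. -/
structure IsGluing (G : SimpleGraph V) (S A B : Set V) (v : V) : Prop where
  union : A ∪ B = S
  inter : A ∩ B = {v}
  left : (G.induce A).Connected
  right : (G.induce B).Connected
  not_adj : ∀ a ∈ A, ∀ b ∈ B, a ≠ v → b ≠ v → ¬ G.Adj a b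

namespace IsGluing

variable {G : SimpleGraph V} {S A B : Set V} {v : V}

theorem symm (h : G.IsGluing S A B v) : G.IsGluing S B A v where
  union := by rw [Set.union_comm, h.union]
  inter := by rw [Set.inter_comm, h.inter]
  left := h.right
  right := h.left
  not_adj b hb a ha hbv hav := fun hadj => h.not_adj a ha b hb hav hbv hadj.symm

theorem mem_left (h : G.IsGluing S A B v) : v ∈ A :=
  (h.inter.ge (Set.mem_singleton v)).1

theorem mem_right (h : G.IsGluing S A B v) : v ∈ B := h.symm.mem_left

theorem left_subset (h : G.IsGluing S A B v) : A ⊆ S := h.union ▸ Set.subset_union_left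

theorem right_subset (h : G.IsGluing S A B v) : B ⊆ S := h.symm.left_subset

theorem eq_of_mem (h : G.IsGluing S A B v) {x : V} (ha : x ∈ A) (hb : x ∈ B) : x = v :=
  h.inter.le ⟨ha, hb⟩

theorem mem_or_mem (h : G.IsGluing S A B v) {x : V} (hx : x ∈ S) : x ∈ A ∨ x ∈ B :=
  h.union.ge hx

open scoped Classical in
/-- The distance from `a` in the glued graph, computed inside the two parts. -/
noncomputable def partDist (h : G.IsGluing S A B v) (a : A) (x : S) : ℕ :=
  if hx : x.1 ∈ A then (G.induce A).dist a ⟨x, hx⟩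
  else (G.induce A).dist a ⟨v, h.mem_left⟩ +
    (G.induce B).dist ⟨v, h.mem_right⟩ ⟨x, (h.mem_or_mem x.2).resolve_left hx⟩

theorem partDist_left (h : G.IsGluing S A B v) (a x : A) :
    h.partDist a ⟨x, h.left_subset x.2⟩ = (G.induce A).dist a x := by
  simp [partDist]

/-- The parts overlap only at `v`, where the second summand is zero, so the preference for `A` in
the definition is harmless. -/
theorem partDist_right (h : G.IsGluing S A B v) (a : A) (x : B) :
    h.partDist a ⟨x, h.right_subset x.2⟩ =
      (G.induce A).dist a ⟨v, h.mem_left⟩ + (G.induce B).dist ⟨v, h.mem_right⟩ x := by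
  rw [partDist]
  split_ifs with hx
  · obtain ⟨x, hxB⟩ := x
    obtain rfl : x = v := h.eq_of_mem hx hxB
    simp
  · rfl

/-- Every edge lies inside one part, since `v` belongs to both and no other edge crosses. -/
theorem partDist_le (h : G.IsGluing S A B v) (a : A) (x y : S) (hxy : (G.induce S).Adj x y) :
    h.partDist a y ≤ h.partDist a x + 1 := by
  obtain ⟨x, hx⟩ := x
  obtain ⟨y, hy⟩ := y
  have hxy : G.Adj x y := hxy
  have hA : ∀ (hxA : x ∈ A) (hyA : y ∈ A),
      h.partDist a ⟨y, hy⟩ ≤ h.partDist a ⟨x, hx⟩ + 1 := by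
    intro hxA hyA
    rw [h.partDist_left a ⟨x, hxA⟩, h.partDist_left a ⟨y, hyA⟩]
    exact Adj.dist_le_dist_add_one (G := G.induce A) (x := ⟨x, hxA⟩) (y := ⟨y, hyA⟩) hxy _
  have hB : ∀ (hxB : x ∈ B) (hyB : y ∈ B),
      h.partDist a ⟨y, hy⟩ ≤ h.partDist a ⟨x, hx⟩ + 1 := by
    intro hxB hyB
    rw [h.partDist_right a ⟨x, hxB⟩, h.partDist_right a ⟨y, hyB⟩]
    have := Adj.dist_le_dist_add_one (G := G.induce B) (x := ⟨x, hxB⟩) (y := ⟨y, hyB⟩) hxy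
      ⟨v, h.mem_right⟩
    omega
  rcases h.mem_or_mem hx with hxA | hxB <;> rcases h.mem_or_mem hy with hyA | hyB
  · exact hA hxA hyA
  · by_cases hxv : x = v
    · exact hB (hxv ▸ h.mem_right) hyB
    by_cases hyv : y = v
    · exact hA hxA (hyv ▸ h.mem_left)
    exact absurd hxy (h.not_adj x hxA y hyB hxv hyv)
  · by_cases hxv : x = v
    · exact hA (hxv ▸ h.mem_left) hyA
    by_cases hyv : y = v
    · exact hB hxB (hyv ▸ h.mem_right)
    exact absurd hxy.symm (h.not_adj y hyA x hxB hyv hxv)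
  · exact hB hxB hyB

theorem connected (h : G.IsGluing S A B v) : (G.induce S).Connected := by
  rw [← h.union]
  exact induce_union_connected h.left.preconnected h.right.preconnected ⟨v, h.mem_left, h.mem_right⟩

/-- The upper bound concatenates paths at `v`; the lower bound holds because `partDist` is
1-Lipschitz. -/
theorem dist_eq_partDist (h : G.IsGluing S A B v) (a : A) (x : S) :
    (G.induce S).dist ⟨a, h.left_subset a.2⟩ x = h.partDist a x := by
  apply le_antisymm
  · have hl : ∀ p q : A, (G.induce S).dist ⟨p, h.left_subset p.2⟩ ⟨q, h.left_subset q.2⟩ ≤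
        (G.induce A).dist p q := fun p q =>
      dist_hom_le (induceHomOfLE G h.left_subset).toHom (h.left.preconnected p q)
    have hr : ∀ p q : B, (G.induce S).dist ⟨p, h.right_subset p.2⟩ ⟨q, h.right_subset q.2⟩ ≤
        (G.induce B).dist p q := fun p q =>
      dist_hom_le (induceHomOfLE G h.right_subset).toHom (h.right.preconnected p q)
    obtain ⟨x, hx⟩ := x
    rcases h.mem_or_mem hx with hxA | hxB
    · rw [h.partDist_left a ⟨x, hxA⟩]
      exact hl a ⟨x, hxA⟩
    · rw [h.partDist_right a ⟨x, hxB⟩]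
      exact (h.connected.dist_triangle (v := ⟨v, h.left_subset h.mem_left⟩)).trans
        (add_le_add (hl a ⟨v, h.mem_left⟩) (hr ⟨v, h.mem_right⟩ ⟨x, hxB⟩))
  · refine le_dist_of_lipschitz (h.connected.preconnected _ _) (h.partDist a) ?_ (h.partDist_le a)
    rw [h.partDist_left, dist_self]

theorem dist_left (h : G.IsGluing S A B v) (a a' : A) :
    (G.induce S).dist ⟨a, h.left_subset a.2⟩ ⟨a', h.left_subset a'.2⟩ =
      (G.induce A).dist a a' := by
  rw [h.dist_eq_partDist, h.partDist_left]

theorem dist_left_right (h : G.IsGluing S A B v) (a : A) (b : B) :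
    (G.induce S).dist ⟨a, h.left_subset a.2⟩ ⟨b, h.right_subset b.2⟩ =
      (G.induce S).dist ⟨a, h.left_subset a.2⟩ ⟨v, h.left_subset h.mem_left⟩ +
      (G.induce S).dist ⟨v, h.left_subset h.mem_left⟩ ⟨b, h.right_subset b.2⟩ := by
  rw [h.dist_eq_partDist, h.partDist_right, h.dist_left a ⟨v, h.mem_left⟩,
    h.symm.dist_left ⟨v, h.mem_right⟩ b]

open scoped Classical in
/-- The vertices of one part: the shared vertex and the others. -/
noncomputable def equivLeft (h : G.IsGluing S A B v) :
    Unit ⊕ {x // x ∈ A ∧ x ≠ v} ≃ A where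
  toFun := Sum.elim (fun _ => ⟨v, h.mem_left⟩) (fun x => ⟨x, x.2.1⟩)
  invFun x := if hx : x.1 = v then .inl () else .inr ⟨x, x.2, hx⟩
  left_inv := by
    rintro (x | ⟨x, hx⟩)
    · simp
    · simp [hx.2]
  right_inv := by
    rintro ⟨x, hx⟩
    by_cases hxv : x = v
    · simp [hxv]
    · simp [hxv]

open scoped Classical in
/-- The vertices of a glued graph: the shared vertex and the others on each side. -/
noncomputable def equiv (h : G.IsGluing S A B v) :
    Unit ⊕ ({x // x ∈ A ∧ x ≠ v} ⊕ {x // x ∈ B ∧ x ≠ v}) ≃ S where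
  toFun := Sum.elim (fun _ => ⟨v, h.left_subset h.mem_left⟩)
    (Sum.elim (fun x => ⟨x, h.left_subset x.2.1⟩) (fun x => ⟨x, h.right_subset x.2.1⟩))
  invFun x := if hx : x.1 = v then .inl () else
    if hA : x.1 ∈ A then .inr (.inl ⟨x, hA, hx⟩)
    else .inr (.inr ⟨x, (h.mem_or_mem x.2).resolve_left hA, hx⟩)
  left_inv := by
    rintro (x | ⟨x, hx⟩ | ⟨x, hx⟩)
    · simp
    · simp [hx.1, hx.2]
    · have : x ∉ A := fun hA => hx.2 (h.eq_of_mem hA hx.1)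
      simp [this, hx.2]
  right_inv := by
    rintro ⟨x, hx⟩
    by_cases hxv : x = v
    · simp [hxv]
    · by_cases hA : x ∈ A
      · simp [hxv, hA]
      · simp [hxv, hA]

theorem submatrix_left (h : G.IsGluing S A B v) :
    ((G.induce S).distMatrix.submatrix h.equiv h.equiv).submatrix
      (Sum.map id Sum.inl) (Sum.map id Sum.inl) =
    (G.induce A).distMatrix.submatrix h.equivLeft h.equivLeft := by
  ext i j
  have he : ∀ k, h.equiv (Sum.map id Sum.inl k) =
      ⟨h.equivLeft k, h.left_subset (h.equivLeft k).2⟩ := by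
    rintro (k | k) <;> rfl
  simp only [distMatrix, Matrix.submatrix_apply, Matrix.of_apply, he]
  rw [h.dist_left]

theorem submatrix_right (h : G.IsGluing S A B v) :
    ((G.induce S).distMatrix.submatrix h.equiv h.equiv).submatrix
      (Sum.map id Sum.inr) (Sum.map id Sum.inr) =
    (G.induce B).distMatrix.submatrix h.symm.equivLeft h.symm.equivLeft := by
  ext i j
  have he : ∀ k, h.equiv (Sum.map id Sum.inr k) =
      ⟨h.symm.equivLeft k, h.right_subset (h.symm.equivLeft k).2⟩ := by
    rintro (k | k) <;> rfl
  simp only [distMatrix, Matrix.submatrix_apply, Matrix.of_apply, he]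
  rw [h.symm.dist_left]

variable [Fintype S] [Fintype A] [Fintype B]

open scoped Classical in
theorem cofactorSum_eq_mul (h : G.IsGluing S A B v) :
    (G.induce S).distMatrix.cofactorSum =
      (G.induce A).distMatrix.cofactorSum * (G.induce B).distMatrix.cofactorSum := by
  have : Fintype {x // x ∈ A ∧ x ≠ v} := Fintype.ofInjective (β := A) (fun x => ⟨x, x.2.1⟩)
    fun x y hxy => Subtype.ext (by simpa using hxy)
  have : Fintype {x // x ∈ B ∧ x ≠ v} := Fintype.ofInjective (β := B) (fun x => ⟨x, x.2.1⟩)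
    fun x y hxy => Subtype.ext (by simpa using hxy)
  have := Matrix.cofactorSum_of_glue ((G.induce S).distMatrix.submatrix h.equiv h.equiv)
    (by simp [distMatrix])
    (fun a b => by
      have := h.dist_left_right ⟨a, a.2.1⟩ ⟨b, b.2.1⟩
      simp only [distMatrix, Matrix.submatrix_apply, Matrix.of_apply]
      exact_mod_cast this)
    (fun a b => by
      have := h.symm.dist_left_right ⟨b, b.2.1⟩ ⟨a, a.2.1⟩
      simp only [distMatrix, Matrix.submatrix_apply, Matrix.of_apply]
      exact_mod_cast this)
  rwa [h.submatrix_left, h.submatrix_right, Matrix.cofactorSum_submatrix_equiv,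
    Matrix.cofactorSum_submatrix_equiv, Matrix.cofactorSum_submatrix_equiv] at this

open scoped Classical in
theorem lambdaSingle_eq_add (h : G.IsGluing S A B v)
    (hA : (G.induce A).distMatrix.cofactorSum ≠ 0)
    (hB : (G.induce B).distMatrix.cofactorSum ≠ 0) :
    (G.induce S).lambdaSingle = (G.induce A).lambdaSingle + (G.induce B).lambdaSingle := by
  have : Fintype {x // x ∈ A ∧ x ≠ v} := Fintype.ofInjective (β := A) (fun x => ⟨x, x.2.1⟩)
    fun x y hxy => Subtype.ext (by simpa using hxy)
  have : Fintype {x // x ∈ B ∧ x ≠ v} := Fintype.ofInjective (β := B) (fun x => ⟨x, x.2.1⟩)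
    fun x y hxy => Subtype.ext (by simpa using hxy)
  have := Matrix.det_div_cofactorSum_of_glue
    ((G.induce S).distMatrix.submatrix h.equiv h.equiv)
    (by simp [distMatrix])
    (fun a b => by
      have := h.dist_left_right ⟨a, a.2.1⟩ ⟨b, b.2.1⟩
      simp only [distMatrix, Matrix.submatrix_apply, Matrix.of_apply]
      exact_mod_cast this)
    (fun a b => by
      have := h.symm.dist_left_right ⟨b, b.2.1⟩ ⟨a, a.2.1⟩
      simp only [distMatrix, Matrix.submatrix_apply, Matrix.of_apply]
      exact_mod_cast this)
    (by rwa [h.submatrix_left, Matrix.cofactorSum_submatrix_equiv])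
    (by rwa [h.submatrix_right, Matrix.cofactorSum_submatrix_equiv])
  rwa [h.submatrix_left, h.submatrix_right, Matrix.cofactorSum_submatrix_equiv,
    Matrix.cofactorSum_submatrix_equiv, Matrix.cofactorSum_submatrix_equiv,
    Matrix.det_submatrix_equiv_self, Matrix.det_submatrix_equiv_self,
    Matrix.det_submatrix_equiv_self, ← SimpleGraph.lambdaSingle_eq,
    ← SimpleGraph.lambdaSingle_eq, ← SimpleGraph.lambdaSingle_eq] at this

end IsGluing

end Gluing

end SimpleGraph

namespace SimpleGraph

/-! ### Blocks as vertex sets, and induction over gluings. -/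

section BlockSets

variable {V : Type*} {G : SimpleGraph V} {S T A B : Set V} {v : V}

/-- The vertex set `T` induces a connected subgraph that has no cut-vertex. -/
def IsNonseparable (G : SimpleGraph V) (T : Set V) : Prop :=
  (G.induce T).Connected ∧ ∀ v : T, ¬ (G.induce T).IsCutVertex v

theorem isCutVertex_induce_iff (v : T) :
    (G.induce T).IsCutVertex v ↔ ¬ (G.induce (T \ {v.1})).Preconnected := by
  let e : (G.induce T).induce ({v}ᶜ : Set T) ≃g G.induce (T \ {v.1}) :=
    { toFun := fun x => ⟨x.1.1, x.1.2, fun h => x.2 (Subtype.ext h)⟩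
      invFun := fun x => ⟨⟨x.1, x.2.1⟩, fun h => x.2.2 (congrArg Subtype.val h)⟩
      left_inv := fun _ => rfl
      right_inv := fun _ => rfl
      map_rel_iff' := Iff.rfl }
  rw [IsCutVertex, e.preconnected_iff]

theorem IsNonseparable.preconnected_sdiff (h : G.IsNonseparable T) (v : V) :
    (G.induce (T \ {v})).Preconnected := by
  by_cases hv : v ∈ T
  · have := h.2 ⟨v, hv⟩
    rwa [isCutVertex_induce_iff, not_not] at this
  · rw [Set.sdiff_singleton_eq_self hv]
    exact h.1.preconnected

theorem isNonseparable_pair {w : V} (h : G.Adj v w) : G.IsNonseparable {v, w} := by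
  refine ⟨induce_pair_connected_of_adj h, fun x => ?_⟩
  rw [isCutVertex_induce_iff, not_not]
  have : Subsingleton (({v, w} : Set V) \ {x.1} : Set V) := by
    rw [Set.subsingleton_coe]
    rintro a ⟨ha, hax⟩ b ⟨hb, hbx⟩
    obtain ⟨x, hx⟩ := x
    simp only [Set.mem_insert_iff, Set.mem_singleton_iff] at ha hb hax hbx hx
    grind
  exact Preconnected.of_subsingleton

theorem mem_of_reachable_induce (hP : ∀ a ∈ A, ∀ b ∈ T, G.Adj a b → b ∈ A) {x y : T}
    (h : (G.induce T).Reachable x y) (hx : x.1 ∈ A) : y.1 ∈ A := by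
  obtain ⟨p⟩ := h
  induction p with
  | nil => exact hx
  | cons hxy _ ih => exact ih (hP _ hx _ (Subtype.prop _) hxy)

/-- Only `v` can have edges leaving `A`, so a walk towards `v` stays in `A` until it first meets
`v`. -/
theorem connected_induce_of_closed (hS : (G.induce S).Connected) (hv : v ∈ A) (hAS : A ⊆ S)
    (hA : ∀ a ∈ A, a ≠ v → ∀ b ∈ S, G.Adj a b → b ∈ A) : (G.induce A).Connected := by
  have key : ∀ {x y : S} (_ : (G.induce S).Walk x y) (hx : x.1 ∈ A), y.1 = v →
      (G.induce A).Reachable ⟨x, hx⟩ ⟨v, hv⟩ := by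
    intro x y p
    induction p with
    | nil =>
      rintro hx rfl
      exact Reachable.refl _
    | @cons x z y hxz p ih =>
      intro hx hy
      by_cases hxv : x.1 = v
      · have : (⟨x.1, hx⟩ : A) = ⟨v, hv⟩ := Subtype.ext hxv
        rw [this]
      · have hz : z.1 ∈ A := hA x hx hxv z z.2 hxz
        have hadj : (G.induce A).Adj ⟨x, hx⟩ ⟨z, hz⟩ := hxz
        exact hadj.reachable.trans (ih hz hy)
  have hr : ∀ x : A, (G.induce A).Reachable x ⟨v, hv⟩ := fun x => by
    obtain ⟨p⟩ := hS.preconnected ⟨x, hAS x.2⟩ ⟨v, hAS hv⟩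
    exact key p x.2 rfl
  have : Nonempty A := ⟨⟨v, hv⟩⟩
  exact ⟨fun x y => (hr x).trans (hr y).symm⟩

theorem exists_isGluing (hS : (G.induce S).Connected) (hsep : ¬ G.IsNonseparable S) :
    ∃ v A B, G.IsGluing S A B v ∧ A ≠ {v} ∧ B ≠ {v} := by
  rw [IsNonseparable, not_and] at hsep
  obtain ⟨v, hv⟩ := not_forall.1 (hsep hS)
  rw [not_not, isCutVertex_induce_iff] at hv
  obtain ⟨v, hvS⟩ := v
  simp only [Preconnected, not_forall] at hv
  obtain ⟨x, y, hxy⟩ := hv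
  -- `R` is the component of `x` in `S` minus the cut-vertex. The two parts are `R` with `v` added
  -- and the complement of `R` in `S`; `x` and `y` witness that neither is just `{v}`.
  let R : Set V := {z | ∃ hz : z ∈ S \ {v}, (G.induce (S \ {v})).Reachable x ⟨z, hz⟩}
  have hR : ∀ a ∈ R, ∀ b ∈ S, b ≠ v → G.Adj a b → b ∈ R := by
    rintro a ⟨ha, hxa⟩ b hb hbv hab
    have hadj : (G.induce (S \ {v})).Adj ⟨a, ha⟩ ⟨b, hb, hbv⟩ := hab
    exact ⟨⟨hb, hbv⟩, hxa.trans hadj.reachable⟩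
  have hRS : R ⊆ S := fun z hz => hz.1.1
  have hvR : v ∉ R := fun h => h.1.2 rfl
  have hxR : x.1 ∈ R := ⟨x.2, Reachable.refl _⟩
  have hyR : y.1 ∉ R := fun h => hxy h.2
  have hAS : insert v R ⊆ S := Set.insert_subset hvS hRS
  refine ⟨v, insert v R, S \ R, ⟨?_, ?_, ?_, ?_, ?_⟩, ?_, ?_⟩
  · ext z
    have := @hRS z
    simp only [Set.mem_union, Set.mem_insert_iff, Set.mem_sdiff]
    grind
  · ext z
    simp only [Set.mem_inter_iff, Set.mem_insert_iff, Set.mem_sdiff, Set.mem_singleton_iff]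
    grind
  · refine connected_induce_of_closed hS (Set.mem_insert _ _) hAS ?_
    intro a ha hav b hb hab
    by_cases hbv : b = v
    · exact Or.inl hbv
    · exact Or.inr (hR a (ha.resolve_left hav) b hb hbv hab)
  · refine connected_induce_of_closed hS ⟨hvS, hvR⟩ Set.sdiff_subset ?_
    intro a ha hav b hb hab
    exact ⟨hb, fun hbR => ha.2 (hR b hbR a ha.1 hav hab.symm)⟩
  · intro a ha b hb hav hbv hab
    exact hb.2 (hR a (ha.resolve_left hav) b hb.1 hbv hab)
  · exact fun h => x.2.2 (h.le (Or.inr hxR))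
  · exact fun h => y.2.2 (h.le ⟨y.2.1, hyR⟩)

/-- `T` is the vertex set of a block of the subgraph induced on `S`. -/
def IsBlockSet (G : SimpleGraph V) (S T : Set V) : Prop :=
  Maximal (fun T => T ⊆ S ∧ G.IsNonseparable T) T

theorem IsNonseparable.isBlockSet_iff (h : G.IsNonseparable S) :
    G.IsBlockSet S T ↔ T = S := by
  constructor
  · exact fun hT => hT.prop.1.antisymm (hT.le_of_ge ⟨subset_rfl, h⟩ hT.prop.1)
  · rintro rfl
    exact ⟨⟨subset_rfl, h⟩, fun _ hT _ => hT.1⟩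

namespace IsGluing

/-- Otherwise `T` has points other than `v` strictly on both sides; they stay connected in `T \
{v}`, yet no edge crosses there. -/
theorem nonseparable_subset (h : G.IsGluing S A B v) (hTS : T ⊆ S) (hT : G.IsNonseparable T) :
    T ⊆ A ∨ T ⊆ B := by
  by_contra! hcon
  obtain ⟨⟨x, hxT, hxA⟩, ⟨y, hyT, hyB⟩⟩ := And.intro (Set.not_subset.1 hcon.1)
    (Set.not_subset.1 hcon.2)
  have hxv : x ≠ v := fun e => hxA (e ▸ h.mem_left)
  have hyv : y ≠ v := fun e => hyB (e ▸ h.mem_right)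
  have hyA : y ∈ A := (h.mem_or_mem (hTS hyT)).resolve_right hyB
  have := mem_of_reachable_induce (A := A \ {v}) (G := G) (T := T \ {v}) ?_
    (hT.preconnected_sdiff v ⟨y, hyT, hyv⟩ ⟨x, hxT, hxv⟩) ⟨hyA, hyv⟩
  · exact hxA this.1
  · rintro a ⟨haA, hav⟩ b ⟨hbT, hbv⟩ hab
    refine ⟨(h.mem_or_mem (hTS hbT)).resolve_right fun hbB => ?_, hbv⟩
    exact h.not_adj a haA b hbB hav hbv hab

/-- A neighbour of `v` in `A` gives an edge, a larger nonseparable set. This excludes the only set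
that could be a block of both parts. -/
theorem not_isBlockSet_singleton (h : G.IsGluing S A B v) (hA : A ≠ {v}) :
    ¬ G.IsBlockSet A {v} := by
  intro hmax
  obtain ⟨x, hxA, hxv⟩ : ∃ x ∈ A, x ≠ v := by
    by_contra! hcon
    exact hA (Set.Subset.antisymm hcon (Set.singleton_subset_iff.2 h.mem_left))
  have : Nontrivial A := ⟨⟨x, hxA⟩, ⟨v, h.mem_left⟩, fun e => hxv (congrArg Subtype.val e)⟩
  obtain ⟨w, hw⟩ := h.left.preconnected.exists_adj_of_nontrivial ⟨v, h.mem_left⟩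
  have hadj : G.Adj v w := hw
  have hle := hmax.le_of_ge (y := {v, w.1})
    ⟨Set.insert_subset h.mem_left (Set.singleton_subset_iff.2 w.2), isNonseparable_pair hadj⟩
    (by simp)
  exact hadj.ne' (hle (Or.inr rfl))

theorem isBlockSet_of_left (h : G.IsGluing S A B v) (hA : A ≠ {v}) (hT : G.IsBlockSet A T) :
    G.IsBlockSet S T := by
  refine ⟨⟨hT.prop.1.trans h.left_subset, hT.prop.2⟩, fun T' hT' hle => ?_⟩
  rcases h.nonseparable_subset hT'.1 hT'.2 with hT'A | hT'B
  · exact hT.le_of_ge ⟨hT'A, hT'.2⟩ hle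
  · exfalso
    -- A larger nonseparable set inside `B` would squeeze `T` into `A ∩ B`.
    have hTv : T ⊆ {v} := fun x hx => h.eq_of_mem (hT.prop.1 hx) (hT'B (hle hx))
    have hne : T.Nonempty := Set.nonempty_coe_sort.1 hT.prop.2.1.nonempty
    rw [hne.subset_singleton_iff] at hTv
    exact h.not_isBlockSet_singleton hA (hTv ▸ hT)

theorem isBlockSet_iff (h : G.IsGluing S A B v) (hA : A ≠ {v}) (hB : B ≠ {v}) :
    G.IsBlockSet S T ↔ G.IsBlockSet A T ∨ G.IsBlockSet B T := by
  constructor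
  · intro hT
    refine (h.nonseparable_subset hT.prop.1 hT.prop.2).imp (fun hTA => ?_) (fun hTB => ?_)
    · exact ⟨⟨hTA, hT.prop.2⟩, fun T' hT' => hT.le_of_ge ⟨hT'.1.trans h.left_subset, hT'.2⟩⟩
    · exact ⟨⟨hTB, hT.prop.2⟩, fun T' hT' => hT.le_of_ge ⟨hT'.1.trans h.right_subset, hT'.2⟩⟩
  · rintro (hT | hT)
    · exact h.isBlockSet_of_left hA hT
    · exact h.symm.isBlockSet_of_left hB hT

theorem not_isBlockSet_both (h : G.IsGluing S A B v) (hA : A ≠ {v}) :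
    ¬ (G.IsBlockSet A T ∧ G.IsBlockSet B T) := by
  rintro ⟨hTA, hTB⟩
  have hTv : T ⊆ {v} := fun x hx => h.eq_of_mem (hTA.prop.1 hx) (hTB.prop.1 hx)
  have hne : T.Nonempty := Set.nonempty_coe_sort.1 hTA.prop.2.1.nonempty
  rw [hne.subset_singleton_iff] at hTv
  exact h.not_isBlockSet_singleton hA (hTv ▸ hTA)

end IsGluing

variable [Fintype V]

open scoped Classical in
/-- The vertex sets of the blocks of the subgraph induced on `S`. -/
noncomputable def blockSets (G : SimpleGraph V) (S : Set V) : Finset (Set V) :=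
  Finset.univ.filter (G.IsBlockSet S)

theorem mem_blockSets : T ∈ G.blockSets S ↔ G.IsBlockSet S T := by
  simp [blockSets]

open scoped Classical in
theorem blockSets_eq_union (h : G.IsGluing S A B v) (hA : A ≠ {v}) (hB : B ≠ {v}) :
    G.blockSets S = G.blockSets A ∪ G.blockSets B := by
  ext T
  simp only [Finset.mem_union, mem_blockSets, h.isBlockSet_iff hA hB]

theorem disjoint_blockSets (h : G.IsGluing S A B v) (hA : A ≠ {v}) :
    Disjoint (G.blockSets A) (G.blockSets B) :=
  Finset.disjoint_left.2 fun _ hTA hTB =>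
    h.not_isBlockSet_both hA ⟨mem_blockSets.1 hTA, mem_blockSets.1 hTB⟩

open scoped Classical in
/-- The formulas of Graham, Hoffman and Hosoya for connected induced subgraphs. -/
theorem cofactorSum_and_lambdaSingle_induce (hS : (G.induce S).Connected)
    (hcof : ∀ T ∈ G.blockSets S, (G.induce T).distMatrix.cofactorSum ≠ 0) :
    (G.induce S).distMatrix.cofactorSum =
        ∏ T ∈ G.blockSets S, (G.induce T).distMatrix.cofactorSum ∧
      (G.induce S).lambdaSingle = ∑ T ∈ G.blockSets S, (G.induce T).lambdaSingle := by
  induction hn : S.ncard using Nat.strong_induction_on generalizing S with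
  | _ n ih =>
    by_cases hsep : G.IsNonseparable S
    · have : G.blockSets S = {S} := by
        ext T
        rw [mem_blockSets, hsep.isBlockSet_iff, Finset.mem_singleton]
      rw [this, Finset.prod_singleton, Finset.sum_singleton]
      exact ⟨rfl, rfl⟩
    · obtain ⟨v, A, B, h, hA, hB⟩ := exists_isGluing hS hsep
      have hlt : ∀ {A B : Set V}, G.IsGluing S A B v → B ≠ {v} → A.ncard < n := by
        intro A B h hB
        rw [← hn]
        refine Set.ncard_lt_ncard (h.left_subset.ssubset_of_ne ?_)
        -- If one part were all of `S`, the other would equal the intersection `{v}`.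
        rintro rfl
        apply hB
        rw [← h.inter, Set.inter_eq_right.2 h.right_subset]
      rw [blockSets_eq_union h hA hB] at hcof ⊢
      have hcA := fun T hT => hcof T (Finset.mem_union_left _ hT)
      have hcB := fun T hT => hcof T (Finset.mem_union_right _ hT)
      obtain ⟨hA1, hA2⟩ := ih _ (hlt h hB) h.left hcA rfl
      obtain ⟨hB1, hB2⟩ := ih _ (hlt h.symm hA) h.right hcB rfl
      rw [Finset.prod_union (disjoint_blockSets h hA), Finset.sum_union (disjoint_blockSets h hA),
        ← hA1, ← hA2, ← hB1, ← hB2]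
      -- Both formulas are carried through the induction together: the product formula for each part
      -- supplies the nonvanishing that additivity of `λ` needs.
      refine ⟨h.cofactorSum_eq_mul, h.lambdaSingle_eq_add ?_ ?_⟩
      · rw [hA1]
        exact Finset.prod_ne_zero_iff.2 hcA
      · rw [hB1]
        exact Finset.prod_ne_zero_iff.2 hcB

end BlockSets

/-! ### Blocks as subgraphs correspond to blocks as vertex sets. -/

section Blocks

variable {V : Type*} {G : SimpleGraph V}

/-- Adding all edges of `G` between the vertices of `H` preserves connectedness, also after deleting
a vertex. -/
theorem isNonseparable_verts {H : G.Subgraph} (hc : H.Connected)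
    (hcut : ∀ v : H.verts, ¬ H.coe.IsCutVertex v) : G.IsNonseparable H.verts := by
  have hle : H.coe ≤ G.induce H.verts := fun _ _ h => H.adj_sub h
  refine ⟨hc.coe.mono hle, fun v hv => hv ?_⟩
  exact (not_not.1 (hcut v)).mono fun _ _ h => hle h

theorem Subgraph.IsInduced.coe_eq {H : G.Subgraph} (h : H.IsInduced) :
    H.coe = G.induce H.verts := by
  ext a b
  simp [h.adj]

theorem IsNonseparable.induce_top {T : Set V} (h : G.IsNonseparable T) :
    ((⊤ : G.Subgraph).induce T).Connected ∧
      ∀ v : ((⊤ : G.Subgraph).induce T).verts,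
        ¬ ((⊤ : G.Subgraph).induce T).coe.IsCutVertex v := by
  have hind : ((⊤ : G.Subgraph).induce T).IsInduced :=
    (Subgraph.isInduced_iff_exists_eq_induce_top _).2 ⟨T, rfl⟩
  rw [Subgraph.connected_iff', hind.coe_eq]
  exact h

theorem IsBlock.isInduced {H : G.Subgraph} (h : G.IsBlock H) : H.IsInduced := by
  have hle : H ≤ (⊤ : G.Subgraph).induce H.verts := Subgraph.le_induce_top_verts
  have := h.le_of_ge (isNonseparable_verts h.prop.1 h.prop.2).induce_top hle
  exact (Subgraph.isInduced_iff_exists_eq_induce_top _).2 ⟨H.verts, le_antisymm hle this⟩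

theorem IsBlock.isBlockSet {H : G.Subgraph} (h : G.IsBlock H) :
    G.IsBlockSet Set.univ H.verts := by
  refine ⟨⟨Set.subset_univ _, isNonseparable_verts h.prop.1 h.prop.2⟩, fun T hT hle => ?_⟩
  have := h.le_of_ge hT.2.induce_top
    (Subgraph.le_induce_top_verts.trans (Subgraph.induce_mono_right hle))
  exact this.1

theorem IsBlockSet.isBlock {T : Set V} (h : G.IsBlockSet Set.univ T) :
    G.IsBlock ((⊤ : G.Subgraph).induce T) := by
  refine ⟨h.prop.2.induce_top, fun H hH hle => ?_⟩
  have := h.le_of_ge ⟨Set.subset_univ _, isNonseparable_verts hH.1 hH.2⟩ hle.1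
  exact Subgraph.le_induce_top_verts.trans (Subgraph.induce_mono_right this)

theorem mem_blocks [Fintype V] {H : G.Subgraph} : H ∈ G.blocks ↔ G.IsBlock H := by
  simp [blocks]

/-- By maximality blocks are induced subgraphs, hence determined by their vertex sets. -/
theorem verts_bijOn_blocks [Fintype V] :
    Set.BijOn Subgraph.verts (G.blocks : Set G.Subgraph) (G.blockSets Set.univ) := by
  refine ⟨fun H hH => ?_, fun H hH H' hH' e => ?_, fun T hT => ?_⟩
  · exact mem_blockSets.2 (mem_blocks.1 hH).isBlockSet
  · rw [← (mem_blocks.1 hH).isInduced.induce_top_verts,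
      ← (mem_blocks.1 hH').isInduced.induce_top_verts, e]
  · exact ⟨_, mem_blocks.2 (mem_blockSets.1 hT).isBlock, rfl⟩

end Blocks

end SimpleGraph

open scoped Classical in
theorem mainTheorem2 {V : Type*} [Fintype V] (G : SimpleGraph V) (hG : G.IsMultiBlock)
    (hcof : ∀ B ∈ G.blocks, B.coe.distMatrix.cofactorSum ≠ 0) :
    G.distMatrix.det = G.lambdaMulti * ∏ B ∈ G.blocks, B.coe.distMatrix.cofactorSum ∧
    G.lambdaMulti * ∏ B ∈ G.blocks, B.coe.distMatrix.cofactorSum =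
      G.lambdaMulti * G.distMatrix.cofactorSum := by
  have hiso : ∀ B ∈ G.blocks, Nonempty (B.coe ≃g G.induce B.verts) := fun B hB => by
    rw [(SimpleGraph.mem_blocks.1 hB).isInduced.coe_eq]
    exact ⟨SimpleGraph.Iso.refl⟩
  have hcofB : ∀ B ∈ G.blocks, B.coe.distMatrix.cofactorSum =
      (G.induce B.verts).distMatrix.cofactorSum := fun B hB =>
    (hiso B hB).some.cofactorSum_distMatrix
  have hlamB : ∀ B ∈ G.blocks, B.coe.lambdaSingle = (G.induce B.verts).lambdaSingle :=
    fun B hB => (hiso B hB).some.lambdaSingle_eq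
  obtain ⟨hmaps, hinj, hsurj⟩ := SimpleGraph.verts_bijOn_blocks (G := G)
  have hprod : ∏ B ∈ G.blocks, B.coe.distMatrix.cofactorSum =
      ∏ T ∈ G.blockSets Set.univ, (G.induce T).distMatrix.cofactorSum :=
    Finset.prod_nbij SimpleGraph.Subgraph.verts hmaps hinj hsurj hcofB
  have hsum : G.lambdaMulti = ∑ T ∈ G.blockSets Set.univ, (G.induce T).lambdaSingle :=
    Finset.sum_nbij SimpleGraph.Subgraph.verts hmaps hinj hsurj hlamB
  have hne : ∀ T ∈ G.blockSets Set.univ, (G.induce T).distMatrix.cofactorSum ≠ 0 := by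
    intro T hT
    obtain ⟨B, hB, rfl⟩ := hsurj hT
    rw [← hcofB B hB]
    exact hcof B hB
  let e : G.induce Set.univ ≃g G := SimpleGraph.induceUnivIso G
  obtain ⟨h1, h2⟩ := SimpleGraph.cofactorSum_and_lambdaSingle_induce
    (e.connected_iff.2 hG.1) hne
  replace h1 : G.distMatrix.cofactorSum = ∏ B ∈ G.blocks, B.coe.distMatrix.cofactorSum := by
    rw [hprod, ← h1]
    convert e.symm.cofactorSum_distMatrix
  replace h2 : G.distMatrix.det / G.distMatrix.cofactorSum = G.lambdaMulti := by
    rw [hsum, ← h2, ← SimpleGraph.lambdaSingle_eq]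
    convert e.symm.lambdaSingle_eq
  have h0 : G.distMatrix.cofactorSum ≠ 0 := by
    rw [h1]
    exact Finset.prod_ne_zero_iff.2 hcof
  rw [← h1]
  exact ⟨(div_eq_iff h0).1 h2, rfl⟩
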